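/- Let $n\ge 1$ be an integer, let $\nu_1,\dots,\nu_n>0$, and let $w:\mathbb{R}\to[0,\infty)$ be bounded above, $1$-periodic, and positive at more than $n$ points of $[0,1)$ (that is, of the torus $\mathbb{T}=\mathbb{R}/\mathbb{Z}$). For $\mathbf z=(z_1,\dots,z_n)\in\mathbb{C}^n$ put $$T(\mathbf z;t):=\prod_{j=1}^n|\sin\pi(t-z_j)|^{\nu_j}\quad(t\in\mathbb{R}),\qquad \|T(\mathbf z;\cdot)\|_w:=\sup_{t\in\mathbb{R}}w(t)\,T(\mathbf z;t).$$ Call $\mathbf z$ admissible if there is $c\in[0,1)$ with $c\le\Re z_1\le\dots\le\Re z_n\le c+1$, and let $$M:=M(w,\nu):=\inf\{\|T(\mathbf z;\cdot)\|_w:\ \mathbf z\in\mathbb{C}^n\text{ admissible}\}.$$ Then there is an admissible $\mathbf z^*$ with $\|T(\mathbf z^*;\cdot)\|_w=M$. Moreover, for every such minimizer $\mathbf z^*$, all $z_j^*$ are real, and there is $c\in\mathbb{R}$ with $c<z_1^*<\dots<z_n^*<c+1$ (so the nodes are distinct modulo $1$ and their cyclic ordering is strict). Furthermore, $\mathbf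 z^*$ equioscillates: with $z_{n+1}^*:=z_1^*+1$, $$\sup\{w(t)\,T(\mathbf z^*;t):\ z_j^*\le t\le z_{j+1}^*\}=M\qquad\text{for every } j=1,\dots,n.$$ -/

import Mathlib

noncomputable section

/-- The monic generalized trigonometric polynomial with exponents `ν` and complex nodes `z`,
`T(z; t) = ∏ j, |sin (π (t - z j))| ^ ν j`, as a function of the real variable `t`. -/
def gtp {n : ℕ} (ν : Fin n → ℝ) (z : Fin n → ℂ) (t : ℝ) : ℝ :=
  ∏ j, ‖Complex.sin ((Real.pi : ℂ) * ((t : ℂ) - z j))‖ ^ ν j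

/-- The weighted sup norm `‖f‖_w = sup_t w(t) |f(t)|`. All functions it is applied to are bounded
when multiplied with the (bounded) weight, so that this is a genuine supremum. -/
def weightedSupNorm (w f : ℝ → ℝ) : ℝ :=
  ⨆ t : ℝ, w t * |f t|

/-- The (non-strict) cyclic ordering of the nodes:
`c ≤ Re z₁ ≤ ⋯ ≤ Re zₙ ≤ c + 1` for some `c ∈ [0, 1)`. -/
def CyclicallyOrdered {n : ℕ} (z : Fin n → ℂ) : Prop :=
  ∃ c ∈ Set.Ico (0 : ℝ) 1,
    Monotone (fun j => (z j).re) ∧ ∀ j, c ≤ (z j).re ∧ (z j).re ≤ c + 1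

/-- The minimax value `M(w, ν)`: the infimum of `‖T(z; ·)‖_w` over all complex node systems `z`
having the prescribed cyclic ordering. -/
def minimaxValue {n : ℕ} (w : ℝ → ℝ) (ν : Fin n → ℝ) : ℝ :=
  sInf {r : ℝ | ∃ z : Fin n → ℂ, CyclicallyOrdered z ∧ r = weightedSupNorm w (gtp ν z)}

/-- The node following `x j` cyclically: `x (j+1)`, or `x₁ + 1` if `x j` is the last node. -/
def nextNode {n : ℕ} (x : Fin n → ℝ) (j : Fin n) : ℝ :=
  if h : (j : ℕ) + 1 < n then x ⟨(j : ℕ) + 1, h⟩ else x ⟨0, j.pos⟩ + 1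

end

open Filter Topology Set

/-! Replacing each node by its real part lowers the product pointwise, so it suffices to minimize
over real nodes. There the norm is lower semicontinuous on a compact set and a minimizer exists. A
nonreal node costs a factor `cosh ^ ν > 1` independent of `t`, and the norm is positive, so
minimizers are real.

Equioscillation is a perturbation argument. Suppose the weighted product stays below the norm on one
arc. Move its two end nodes apart, into the complementary arc, with displacements inversely
proportional to their exponents. Strict concavity of `log sin` makes the product drop on the
complementary arc (`exists_contraction_rtp_spread`), while the slack absorbs the change on the
widened arc (`eventually_weightedSupNorm_spread_lt`). Where nodes coincide, the one moved is
outermost in its class modulo 1, so the order survives (`CyclicMono.eventually_spread`). Hence every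
arc carries the full supremum. A degenerate arc carries 0, so the nodes are distinct. -/

/-- The trigonometric product with real nodes. -/
noncomputable def rtp {n : ℕ} (ν x : Fin n → ℝ) (t : ℝ) : ℝ :=
  ∏ j, |Real.sin (Real.pi * (t - x j))| ^ ν j

/-- The cyclic ordering of real nodes, in terms of pairs. -/
def CyclicMono {n : ℕ} (x : Fin n → ℝ) : Prop :=
  ∀ i j, i < j → x i ≤ x j ∧ x j ≤ x i + 1

/-! ### Real and complex products: periodicity, zeros, comparison, positivity of the norm -/

section Basic

variable {n : ℕ} {ν : Fin n → ℝ} {w : ℝ → ℝ}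

theorem gtp_ofReal (x : Fin n → ℝ) : gtp ν (fun j => (x j : ℂ)) = rtp ν x := by
  funext t
  unfold gtp rtp
  refine Finset.prod_congr rfl fun j _ => ?_
  have : Complex.sin ((Real.pi : ℂ) * ((t : ℂ) - (x j : ℂ)))
      = ((Real.sin (Real.pi * (t - x j)) : ℝ) : ℂ) := by push_cast; rfl
  rw [this, Complex.norm_real, Real.norm_eq_abs]

theorem rtp_nonneg (x : Fin n → ℝ) (t : ℝ) : 0 ≤ rtp ν x t :=
  Finset.prod_nonneg fun _ _ => Real.rpow_nonneg (abs_nonneg _) _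

theorem gtp_nonneg (z : Fin n → ℂ) (t : ℝ) : 0 ≤ gtp ν z t :=
  Finset.prod_nonneg fun _ _ => Real.rpow_nonneg (norm_nonneg _) _

theorem Continuous.rtp {X : Type*} [TopologicalSpace X] (hν : ∀ j, 0 < ν j) {f : X → Fin n → ℝ}
    {g : X → ℝ} (hf : Continuous f) (hg : Continuous g) :
    Continuous fun y => rtp ν (f y) (g y) := by
  unfold _root_.rtp
  refine continuous_finsetProd _ fun j _ => Continuous.rpow_const ?_ fun _ => Or.inr (hν j).le
  fun_prop

theorem continuous_rtp (hν : ∀ j, 0 < ν j) (x : Fin n → ℝ) : Continuous (rtp ν x) :=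
  Continuous.rtp hν continuous_const continuous_id

theorem abs_sin_pi_mul_sub_int (u : ℝ) (m : ℤ) :
    |Real.sin (Real.pi * (u - m))| = |Real.sin (Real.pi * u)| := by
  have : Real.pi * (u - m) = Real.pi * u - m * Real.pi := by ring
  rw [this, Real.sin_sub_int_mul_pi, abs_mul, abs_zpow]
  simp

theorem rtp_sub_int (x : Fin n → ℝ) (t : ℝ) (m : ℤ) : rtp ν x (t - m) = rtp ν x t := by
  unfold rtp
  refine Finset.prod_congr rfl fun j _ => ?_
  rw [show t - m - x j = t - x j - m by ring, abs_sin_pi_mul_sub_int]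

theorem rtp_nodes_sub_int (x : Fin n → ℝ) (m : ℤ) :
    rtp ν (fun j => x j - m) = rtp ν x := by
  funext t
  unfold rtp
  refine Finset.prod_congr rfl fun j _ => ?_
  rw [show t - (x j - m) = t - x j - ((-m : ℤ) : ℝ) by push_cast; ring, abs_sin_pi_mul_sub_int]

theorem rtp_eq_zero_of_eq_add_int (hν : ∀ j, 0 < ν j) {x : Fin n → ℝ} {t : ℝ} {j : Fin n} {m : ℤ}
    (h : t = x j + m) : rtp ν x t = 0 := by
  refine Finset.prod_eq_zero (Finset.mem_univ j) ?_
  have : Real.pi * (t - x j) = m * Real.pi := by rw [h]; ring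
  rw [this, Real.sin_int_mul_pi, abs_zero, Real.zero_rpow (hν j).ne']

theorem exists_eq_add_int_of_rtp_eq_zero {x : Fin n → ℝ} {t : ℝ} (h : rtp ν x t = 0) :
    ∃ (j : Fin n) (m : ℤ), t = x j + m := by
  obtain ⟨j, -, hj⟩ := Finset.prod_eq_zero_iff.1 h
  have h0 := ((Real.rpow_eq_zero_iff_of_nonneg (abs_nonneg _)).1 hj).1
  rw [abs_eq_zero, Real.sin_eq_zero_iff] at h0
  obtain ⟨m, hm⟩ := h0
  refine ⟨j, m, ?_⟩
  have := mul_right_cancel₀ Real.pi_ne_zero (hm.trans (mul_comm _ _))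
  linarith

theorem norm_sin_pi_sq (t : ℝ) (z : ℂ) :
    ‖Complex.sin ((Real.pi : ℂ) * ((t : ℂ) - z))‖ ^ 2 =
      Real.sin (Real.pi * (t - z.re)) ^ 2 + Real.sinh (Real.pi * z.im) ^ 2 := by
  have h1 : (Real.pi : ℂ) * ((t : ℂ) - z) =
      ((Real.pi * (t - z.re) : ℝ) : ℂ) + ((-(Real.pi * z.im) : ℝ) : ℂ) * Complex.I := by
    apply Complex.ext <;> simp
  rw [h1, Complex.sin_add_mul_I, ← Complex.ofReal_sin, ← Complex.ofReal_cos, ← Complex.ofReal_sinh,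
    ← Complex.ofReal_cosh, ← Complex.ofReal_mul, ← Complex.ofReal_mul, Complex.sq_norm,
    Complex.normSq_add_mul_I, Real.sinh_neg, Real.cosh_neg]
  rw [mul_pow, mul_pow, Real.cosh_sq, Real.cos_sq']
  ring

/-- Since `sin² ≤ 1`, one has `sin² + sinh² ≥ sin² (1 + sinh²)`. The gain `cosh` does not depend on
`t`, so it passes through the supremum. -/
theorem cosh_mul_abs_sin_le (t : ℝ) (z : ℂ) :
    Real.cosh (Real.pi * z.im) * |Real.sin (Real.pi * (t - z.re))| ≤
      ‖Complex.sin ((Real.pi : ℂ) * ((t : ℂ) - z))‖ := by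
  refine le_of_sq_le_sq ?_ (norm_nonneg _)
  rw [norm_sin_pi_sq, mul_pow, sq_abs, Real.cosh_sq]
  nlinarith [Real.sin_sq_le_one (Real.pi * (t - z.re)), sq_nonneg (Real.sinh (Real.pi * z.im))]

theorem norm_sin_le_cosh (t : ℝ) (z : ℂ) :
    ‖Complex.sin ((Real.pi : ℂ) * ((t : ℂ) - z))‖ ≤ Real.cosh (Real.pi * z.im) := by
  refine le_of_sq_le_sq ?_ (Real.cosh_pos _).le
  rw [norm_sin_pi_sq, Real.cosh_sq]
  nlinarith [Real.sin_sq_le_one (Real.pi * (t - z.re))]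

theorem abs_sin_le_norm_sin (t : ℝ) (z : ℂ) :
    |Real.sin (Real.pi * (t - z.re))| ≤ ‖Complex.sin ((Real.pi : ℂ) * ((t : ℂ) - z))‖ :=
  le_trans (le_mul_of_one_le_left (abs_nonneg _) (Real.one_le_cosh _)) (cosh_mul_abs_sin_le t z)

theorem rtp_re_le_gtp (hν : ∀ j, 0 < ν j) (z : Fin n → ℂ) (t : ℝ) :
    rtp ν (fun j => (z j).re) t ≤ gtp ν z t :=
  Finset.prod_le_prod (fun _ _ => Real.rpow_nonneg (abs_nonneg _) _) fun j _ =>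
    Real.rpow_le_rpow (abs_nonneg _) (abs_sin_le_norm_sin t (z j)) (hν j).le

theorem cosh_rpow_mul_rtp_re_le_gtp (hν : ∀ j, 0 < ν j) (z : Fin n → ℂ) (i : Fin n) (t : ℝ) :
    Real.cosh (Real.pi * (z i).im) ^ ν i * rtp ν (fun j => (z j).re) t ≤ gtp ν z t := by
  unfold rtp gtp
  rw [← Finset.mul_prod_erase _ _ (Finset.mem_univ i), ← Finset.mul_prod_erase _ _ (Finset.mem_univ i),
    ← mul_assoc, ← Real.mul_rpow (Real.cosh_pos _).le (abs_nonneg _)]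
  refine mul_le_mul ?_ ?_ (Finset.prod_nonneg fun _ _ => Real.rpow_nonneg (abs_nonneg _) _)
    (Real.rpow_nonneg (norm_nonneg _) _)
  · exact Real.rpow_le_rpow (by positivity) (cosh_mul_abs_sin_le t (z i)) (hν i).le
  · exact Finset.prod_le_prod (fun _ _ => Real.rpow_nonneg (abs_nonneg _) _) fun j _ =>
      Real.rpow_le_rpow (abs_nonneg _) (abs_sin_le_norm_sin t (z j)) (hν j).le

theorem bddAbove_weighted_gtp (hν : ∀ j, 0 < ν j) (hw_nonneg : ∀ t, 0 ≤ w t)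
    (hw_bdd : BddAbove (range w)) (z : Fin n → ℂ) :
    BddAbove (range fun t => w t * |gtp ν z t|) := by
  obtain ⟨B, hB⟩ := hw_bdd
  refine ⟨B * ∏ j, Real.cosh (Real.pi * (z j).im) ^ ν j, ?_⟩
  rintro _ ⟨t, rfl⟩
  have hwt : w t ≤ B := hB ⟨t, rfl⟩
  simp only [abs_of_nonneg (gtp_nonneg z t)]
  refine mul_le_mul hwt ?_ (gtp_nonneg z t) ((hw_nonneg t).trans hwt)
  exact Finset.prod_le_prod (fun _ _ => Real.rpow_nonneg (norm_nonneg _) _) fun j _ =>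
    Real.rpow_le_rpow (norm_nonneg _) (norm_sin_le_cosh t (z j)) (hν j).le

theorem bddAbove_weighted_rtp (hν : ∀ j, 0 < ν j) (hw_nonneg : ∀ t, 0 ≤ w t)
    (hw_bdd : BddAbove (range w)) (x : Fin n → ℝ) :
    BddAbove (range fun t => w t * |rtp ν x t|) := by
  simpa only [gtp_ofReal] using bddAbove_weighted_gtp hν hw_nonneg hw_bdd fun j => (x j : ℂ)

theorem le_weightedSupNorm_rtp (hν : ∀ j, 0 < ν j) (hw_nonneg : ∀ t, 0 ≤ w t)
    (hw_bdd : BddAbove (range w)) (x : Fin n → ℝ) (t : ℝ) :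
    w t * rtp ν x t ≤ weightedSupNorm w (rtp ν x) := by
  have := le_ciSup (bddAbove_weighted_rtp hν hw_nonneg hw_bdd x) t
  rwa [abs_of_nonneg (rtp_nonneg x t)] at this

theorem weightedSupNorm_nonneg (hw_nonneg : ∀ t, 0 ≤ w t) (f : ℝ → ℝ) :
    0 ≤ weightedSupNorm w f :=
  Real.iSup_nonneg fun t => mul_nonneg (hw_nonneg t) (abs_nonneg _)

theorem weightedSupNorm_rtp_le {x : Fin n → ℝ} {C : ℝ} (h : ∀ t, w t * rtp ν x t ≤ C) :
    weightedSupNorm w (rtp ν x) ≤ C :=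
  ciSup_le fun t => by rw [abs_of_nonneg (rtp_nonneg x t)]; exact h t

theorem weightedSupNorm_rtp_re_le (hν : ∀ j, 0 < ν j) (hw_nonneg : ∀ t, 0 ≤ w t)
    (hw_bdd : BddAbove (range w)) (z : Fin n → ℂ) :
    weightedSupNorm w (rtp ν fun j => (z j).re) ≤ weightedSupNorm w (gtp ν z) := by
  refine ciSup_mono (bddAbove_weighted_gtp hν hw_nonneg hw_bdd z) fun t => ?_
  rw [abs_of_nonneg (rtp_nonneg _ t), abs_of_nonneg (gtp_nonneg z t)]
  exact mul_le_mul_of_nonneg_left (rtp_re_le_gtp hν z t) (hw_nonneg t)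

theorem cosh_rpow_mul_weightedSupNorm_le (hν : ∀ j, 0 < ν j) (hw_nonneg : ∀ t, 0 ≤ w t)
    (hw_bdd : BddAbove (range w)) (z : Fin n → ℂ) (i : Fin n) :
    Real.cosh (Real.pi * (z i).im) ^ ν i * weightedSupNorm w (rtp ν fun j => (z j).re) ≤
      weightedSupNorm w (gtp ν z) := by
  unfold weightedSupNorm
  rw [Real.mul_iSup_of_nonneg (Real.rpow_nonneg (Real.cosh_pos _).le _)]
  refine ciSup_mono (bddAbove_weighted_gtp hν hw_nonneg hw_bdd z) fun t => ?_
  rw [abs_of_nonneg (rtp_nonneg _ t), abs_of_nonneg (gtp_nonneg z t), mul_left_comm]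
  exact mul_le_mul_of_nonneg_left (cosh_rpow_mul_rtp_re_le_gtp hν z i t) (hw_nonneg t)

/-- The product vanishes at no more than `n` points of `[0, 1)`, so some point of positive weight is
not a zero. -/
theorem weightedSupNorm_rtp_pos (hν : ∀ j, 0 < ν j) (hw_nonneg : ∀ t, 0 ≤ w t)
    (hw_bdd : BddAbove (range w))
    (hw_pos : (n : ℕ∞) < Set.encard {t : ℝ | t ∈ Set.Ico (0 : ℝ) 1 ∧ 0 < w t})
    (x : Fin n → ℝ) : 0 < weightedSupNorm w (rtp ν x) := by
  have hcard : (range fun j => Int.fract (x j)).encard ≤ n := by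
    rw [← image_univ]
    refine (encard_image_le _ _).trans ?_
    simp
  obtain ⟨t, ⟨ht, hwt⟩, hnot⟩ := not_subset.1 fun hsub =>
    absurd ((encard_le_encard hsub).trans hcard) (not_le.2 hw_pos)
  have hne : rtp ν x t ≠ 0 := fun h0 => by
    obtain ⟨j, m, hm⟩ := exists_eq_add_int_of_rtp_eq_zero h0
    refine hnot ⟨j, ?_⟩
    have : x j = t - m := by linarith
    simp only [this, Int.fract_sub_intCast]
    exact Int.fract_eq_self.2 ht
  exact lt_of_lt_of_le (mul_pos hwt ((rtp_nonneg x t).lt_of_ne' hne))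
    (le_weightedSupNorm_rtp hν hw_nonneg hw_bdd x t)

end Basic

/-! ### Existence of a minimizer -/

section Minimax

variable {n : ℕ} {ν : Fin n → ℝ} {w : ℝ → ℝ}

theorem CyclicallyOrdered.cyclicMono {z : Fin n → ℂ} (hz : CyclicallyOrdered z) :
    CyclicMono fun j => (z j).re := by
  obtain ⟨c, -, hmono, hc⟩ := hz
  intro i j hij
  have := (hc i).1
  have := (hc j).2
  exact ⟨hmono hij.le, by linarith⟩

theorem CyclicMono.cyclicallyOrdered (hn : 1 ≤ n) {x : Fin n → ℝ} (hx : CyclicMono x) :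
    CyclicallyOrdered fun j => ((x j - ⌊x ⟨0, hn⟩⌋ : ℝ) : ℂ) := by
  have hle : ∀ i j, i ≤ j → x i ≤ x j ∧ x j ≤ x i + 1 := fun i j hij => by
    rcases hij.eq_or_lt with rfl | h
    · exact ⟨le_rfl, by linarith⟩
    · exact hx i j h
  refine ⟨Int.fract (x ⟨0, hn⟩), ⟨Int.fract_nonneg _, Int.fract_lt_one _⟩, fun i j hij => ?_,
    fun j => ?_⟩
  · simpa using (hle i j hij).1
  · have := hle ⟨0, hn⟩ j (Nat.zero_le _)
    simp only [Complex.ofReal_re, Int.fract]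
    constructor <;> linarith

theorem minimaxValue_le {z : Fin n → ℂ} (hw_nonneg : ∀ t, 0 ≤ w t) (hz : CyclicallyOrdered z) :
    minimaxValue w ν ≤ weightedSupNorm w (gtp ν z) :=
  csInf_le ⟨0, by rintro _ ⟨z, -, rfl⟩; exact weightedSupNorm_nonneg hw_nonneg _⟩ ⟨z, hz, rfl⟩

theorem minimaxValue_le_of_cyclicMono (hn : 1 ≤ n) (hw_nonneg : ∀ t, 0 ≤ w t) {x : Fin n → ℝ}
    (hx : CyclicMono x) : minimaxValue w ν ≤ weightedSupNorm w (rtp ν x) := by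
  have := minimaxValue_le (ν := ν) hw_nonneg (hx.cyclicallyOrdered hn)
  rwa [gtp_ofReal, rtp_nodes_sub_int] at this

/-- A supremum over `t` of functions continuous in the nodes; no regularity of `w` in `t` is
involved. -/
theorem lowerSemicontinuous_weightedSupNorm_rtp (hν : ∀ j, 0 < ν j) (hw_nonneg : ∀ t, 0 ≤ w t)
    (hw_bdd : BddAbove (range w)) :
    LowerSemicontinuous fun x : Fin n → ℝ => weightedSupNorm w (rtp ν x) := by
  refine lowerSemicontinuous_ciSup (fun x => bddAbove_weighted_rtp hν hw_nonneg hw_bdd x)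
    fun t => Continuous.lowerSemicontinuous ?_
  exact continuous_const.mul (Continuous.rtp hν continuous_id continuous_const).abs

theorem isClosed_setOf_cyclicMono : IsClosed {x : Fin n → ℝ | CyclicMono x} := by
  simp only [CyclicMono, ofPred_forall]
  refine isClosed_iInter fun i => isClosed_iInter fun j => isClosed_iInter fun _ => ?_
  exact (isClosed_le (continuous_apply i) (continuous_apply j)).inter
    (isClosed_le (continuous_apply j) ((continuous_apply i).add continuous_const))

theorem exists_minimizer (hn : 1 ≤ n) (hν : ∀ j, 0 < ν j) (hw_nonneg : ∀ t, 0 ≤ w t)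
    (hw_bdd : BddAbove (range w)) :
    ∃ z : Fin n → ℂ, CyclicallyOrdered z ∧ weightedSupNorm w (gtp ν z) = minimaxValue w ν := by
  -- The box `[0, 2]` contains `[c, c + 1]` for every `c ∈ [0, 1)`.
  set K : Set (Fin n → ℝ) := {x | CyclicMono x} ∩ Icc (fun _ => 0) (fun _ => 2) with hK
  have hKc : IsCompact K := isCompact_Icc.inter_left isClosed_setOf_cyclicMono
  have hKne : K.Nonempty := ⟨fun _ => 0, fun _ _ _ => by norm_num, le_rfl, fun _ => by norm_num⟩
  obtain ⟨x, hxK, hmin⟩ := LowerSemicontinuousOn.exists_isMinOn hKne hKc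
    ((lowerSemicontinuous_weightedSupNorm_rtp (ν := ν) hν hw_nonneg hw_bdd).lowerSemicontinuousOn K)
  have hxo := hxK.1.cyclicallyOrdered hn
  refine ⟨_, hxo, le_antisymm ?_ (minimaxValue_le hw_nonneg hxo)⟩
  refine le_csInf ⟨_, _, hxo, rfl⟩ ?_
  rintro _ ⟨z, hz, rfl⟩
  rw [gtp_ofReal, rtp_nodes_sub_int]
  refine le_trans (hmin ⟨hz.cyclicMono, ?_⟩) (weightedSupNorm_rtp_re_le hν hw_nonneg hw_bdd z)
  obtain ⟨c, hc, -, hcz⟩ := hz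
  exact ⟨fun j => hc.1.trans (hcz j).1, fun j => by have := (hcz j).2; have := hc.2; linarith⟩

end Minimax

/-! ### Concavity of `log sin` and spreading two zeros -/

theorem strictConcaveOn_log_sin :
    StrictConcaveOn ℝ (Ioo 0 Real.pi) fun u => Real.log (Real.sin u) := by
  refine ⟨convex_Ioo _ _, fun u hu v hv huv a b ha hb hab => ?_⟩
  have hsu := Real.sin_pos_of_pos_of_lt_pi hu.1 hu.2
  have hsv := Real.sin_pos_of_pos_of_lt_pi hv.1 hv.2
  have hpos : 0 < a • Real.sin u + b • Real.sin v := by simp only [smul_eq_mul]; positivity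
  exact lt_of_le_of_lt (strictConcaveOn_log_Ioi.concaveOn.2 hsu hsv ha.le hb.le hab)
    (Real.log_lt_log hpos (strictConcaveOn_sin_Icc.2 (Ioo_subset_Icc_self hu)
      (Ioo_subset_Icc_self hv) huv ha hb hab))

/-- A strictly concave function is pushed down, on weighted sum, by spreading two points apart while
preserving their weighted mean. -/
theorem StrictConcaveOn.weighted_spread_lt {s : Set ℝ} {f : ℝ → ℝ} (hf : StrictConcaveOn ℝ s f)
    {u v p q h : ℝ} (hp : 0 < p) (hq : 0 < q) (hh : 0 < h) (hvu : v ≤ u)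
    (hv : v - h / q ∈ s) (hu : u + h / p ∈ s) :
    p * f (u + h / p) + q * f (v - h / q) < p * f u + q * f v := by
  have hhp : 0 < h / p := by positivity
  have hhq : 0 < h / q := by positivity
  have hs := hf.1.ordConnected.out hv hu
  have hvs : v ∈ s := hs ⟨by linarith, by linarith⟩
  have hus : u ∈ s := hs ⟨by linarith, by linarith⟩
  -- Chord slopes decrease to the right; when `v < u` the chord over `[v, u]` is the intermediate
  -- one.
  have key : (f (u + h / p) - f u) / (h / p) < (f v - f (v - h / q)) / (h / q) := by
    rcases hvu.eq_or_lt with rfl | hlt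
    · have := hf.slope_anti_adjacent hv hu (show v - h / q < v by linarith)
        (show v < v + h / p by linarith)
      rwa [add_sub_cancel_left, sub_sub_cancel] at this
    · have h1 := hf.slope_anti_adjacent hv hus (show v - h / q < v by linarith) hlt
      have h2 := hf.slope_anti_adjacent hvs hu hlt (show u < u + h / p by linarith)
      rw [sub_sub_cancel] at h1
      rw [add_sub_cancel_left] at h2
      exact h2.trans h1
  have e1 : (f (u + h / p) - f u) / (h / p) = p * (f (u + h / p) - f u) / h := by field_simp
  have e2 : (f v - f (v - h / q)) / (h / q) = q * (f v - f (v - h / q)) / h := by field_simp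
  rw [e1, e2, div_lt_div_iff_of_pos_right hh] at key
  linarith

/-- Two zeros of a trigonometric product moved away from each other lower it on the opposite arc. -/
theorem abs_sin_rpow_mul_spread_lt {a b t p q h : ℝ} (hp : 0 < p) (hq : 0 < q) (hh : 0 < h)
    (hab : a ≤ b) (hbt : b + h / q < t) (hta : t + h / p < a + 1) :
    |Real.sin (Real.pi * (t - (a - h / p)))| ^ p * |Real.sin (Real.pi * (t - (b + h / q)))| ^ q <
      |Real.sin (Real.pi * (t - a))| ^ p * |Real.sin (Real.pi * (t - b))| ^ q := by
  have hhp : 0 < h / p := by positivity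
  have hhq : 0 < h / q := by positivity
  have hpi := Real.pi_pos
  have mem : ∀ u, 0 < u → u < 1 → Real.pi * u ∈ Ioo 0 Real.pi := fun u h0 h1 =>
    ⟨by positivity, by nlinarith⟩
  have pos : ∀ u, 0 < u → u < 1 → 0 < Real.sin (Real.pi * u) := fun u h0 h1 =>
    Real.sin_pos_of_pos_of_lt_pi (mem u h0 h1).1 (mem u h0 h1).2
  have i1 := pos (t - (a - h / p)) (by linarith) (by linarith)
  have i2 := pos (t - (b + h / q)) (by linarith) (by linarith)
  have i3 := pos (t - a) (by linarith) (by linarith)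
  have i4 := pos (t - b) (by linarith) (by linarith)
  rw [abs_of_pos i1, abs_of_pos i2, abs_of_pos i3, abs_of_pos i4]
  rw [← Real.log_lt_log_iff (by positivity) (by positivity), Real.log_mul (by positivity)
    (by positivity), Real.log_mul (by positivity) (by positivity), Real.log_rpow i1,
    Real.log_rpow i2, Real.log_rpow i3, Real.log_rpow i4]
  have e1 : Real.pi * (t - (a - h / p)) = Real.pi * (t - a) + Real.pi * h / p := by ring
  have e2 : Real.pi * (t - (b + h / q)) = Real.pi * (t - b) - Real.pi * h / q := by ring
  have m1 := mem (t - (a - h / p)) (by linarith) (by linarith)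
  have m2 := mem (t - (b + h / q)) (by linarith) (by linarith)
  rw [e1] at m1 ⊢
  rw [e2] at m2 ⊢
  exact strictConcaveOn_log_sin.weighted_spread_lt hp hq (by positivity)
    (by nlinarith) m2 m1

/-- The direction that moves the node `i` to the left and the node `k` to the right. -/
noncomputable def spread {n : ℕ} (ν : Fin n → ℝ) (i k j : Fin n) : ℝ :=
  if j = i then -(1 / ν i) else if j = k then 1 / ν k else 0

/-! ### Effect of spreading two nodes on the norm -/

section Perturbation

variable {n : ℕ} {ν : Fin n → ℝ} {w : ℝ → ℝ}

theorem rtp_eq_mul_mul_prod_erase (x : Fin n → ℝ) {i k : Fin n} (hik : i ≠ k) (t : ℝ) :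
    rtp ν x t = (|Real.sin (Real.pi * (t - x i))| ^ ν i * |Real.sin (Real.pi * (t - x k))| ^ ν k) *
      ∏ j ∈ (Finset.univ.erase i).erase k, |Real.sin (Real.pi * (t - x j))| ^ ν j := by
  unfold rtp
  rw [← Finset.mul_prod_erase _ _ (Finset.mem_univ i),
    ← Finset.mul_prod_erase _ _ (Finset.mem_erase.2 ⟨hik.symm, Finset.mem_univ k⟩), mul_assoc]

theorem exists_weighted_rtp_le_near_zero (hν : ∀ j, 0 < ν j)
    (hw_bdd : BddAbove (range w)) {δ : ℝ} (hδ : 0 < δ) {x : Fin n → ℝ} {c : ℝ}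
    (hc : rtp ν x c = 0) : ∃ η > 0, ∀ t, |t - c| ≤ η → w t * rtp ν x t ≤ δ := by
  obtain ⟨B, hB⟩ := hw_bdd
  have hcx : Continuous (rtp ν x) := continuous_rtp hν x
  have h1 : ∀ᶠ t in 𝓝 c, B * rtp ν x t < δ := by
    have hB0 : Continuous fun t => B * rtp ν x t := continuous_const.mul hcx
    exact (hB0.tendsto c).eventually_lt_const (by simpa only [hc, mul_zero] using hδ)
  obtain ⟨η, hη, hball⟩ := Metric.eventually_nhds_iff.1 h1
  refine ⟨η / 2, by positivity, fun t ht => ?_⟩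
  have := hball (show dist t c < η by rw [Real.dist_eq]; linarith)
  exact (mul_le_mul_of_nonneg_right (hB ⟨t, rfl⟩) (rtp_nonneg x t)).trans this.le

/-- Moving two nodes away from each other contracts the product on the opposite arc. -/
theorem exists_contraction_rtp_spread (hν : ∀ j, 0 < ν j) {x : Fin n → ℝ} {i k : Fin n}
    (hik : i ≠ k) {a b : ℝ} {m l : ℤ} (ha : x i = a + m) (hb : x k = b + l) (hab : a ≤ b)
    {h η : ℝ} (hh : 0 < h) (hi : h / ν i < η) (hk : h / ν k < η) :
    ∃ ρ, 0 ≤ ρ ∧ ρ < 1 ∧ ∀ t ∈ Icc (b + η) (a + 1 - η),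
      rtp ν (fun j => x j + h * spread ν i k j) t ≤ ρ * rtp ν x t := by
  set x' := fun j => x j + h * spread ν i k j with hx'
  have hx'i : x' i = a - h / ν i + m := by simp only [hx', spread, if_true, ha]; ring
  have hx'k : x' k = b + h / ν k + l := by
    simp only [hx', spread, if_neg hik.symm, if_true, hb]; ring
  set A : ℝ → ℝ := fun t =>
    |Real.sin (Real.pi * (t - a))| ^ ν i * |Real.sin (Real.pi * (t - b))| ^ ν k with hA
  set A' : ℝ → ℝ := fun t => |Real.sin (Real.pi * (t - (a - h / ν i)))| ^ ν i *
    |Real.sin (Real.pi * (t - (b + h / ν k)))| ^ ν k with hA'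
  have hlt : ∀ t ∈ Icc (b + η) (a + 1 - η), A' t < A t := fun t ht =>
    abs_sin_rpow_mul_spread_lt (hν i) (hν k) hh hab (by linarith [ht.1]) (by linarith [ht.2])
  have hA'0 : ∀ t, 0 ≤ A' t := fun t => by positivity
  have hfac : ∀ (c : ℝ) (p : Fin n), Continuous fun t : ℝ => |Real.sin (Real.pi * (t - c))| ^ ν p := fun c p =>
    Continuous.rpow_const (by fun_prop) fun _ => Or.inr (hν p).le
  have hAc : Continuous A := (hfac _ _).mul (hfac _ _)
  have hA'c : Continuous A' := (hfac _ _).mul (hfac _ _)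
  -- Compactness turns the pointwise strict inequality into one factor `ρ`, the maximum of `A' / A`.
  -- A factor, unlike a difference, survives multiplication by the other sines and by `w`.
  have hρ : ∃ ρ, 0 ≤ ρ ∧ ρ < 1 ∧ ∀ t ∈ Icc (b + η) (a + 1 - η), A' t ≤ ρ * A t := by
    rcases (Icc (b + η) (a + 1 - η)).eq_empty_or_nonempty with he | hne
    · exact ⟨0, le_rfl, one_pos, by simp [he]⟩
    · obtain ⟨t₀, ht₀, hmax⟩ := isCompact_Icc.exists_isMaxOn hne
        (hA'c.continuousOn.div hAc.continuousOn fun t ht => ((hA'0 t).trans_lt (hlt t ht)).ne')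
      have hp₀ := (hA'0 t₀).trans_lt (hlt t₀ ht₀)
      refine ⟨A' t₀ / A t₀, div_nonneg (hA'0 _) hp₀.le, (div_lt_one hp₀).2 (hlt t₀ ht₀),
        fun t ht => ?_⟩
      exact (div_le_iff₀ ((hA'0 t).trans_lt (hlt t ht))).1 (hmax ht)
  obtain ⟨ρ, h0, h1, hle⟩ := hρ
  refine ⟨ρ, h0, h1, fun t ht => ?_⟩
  rw [rtp_eq_mul_mul_prod_erase x hik, rtp_eq_mul_mul_prod_erase x' hik, ← mul_assoc]
  have hrest : ∏ j ∈ (Finset.univ.erase i).erase k, |Real.sin (Real.pi * (t - x' j))| ^ ν j =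
      ∏ j ∈ (Finset.univ.erase i).erase k, |Real.sin (Real.pi * (t - x j))| ^ ν j := by
    refine Finset.prod_congr rfl fun j hj => ?_
    simp only [Finset.mem_erase] at hj
    simp [hx', spread, hj.1, hj.2.1]
  have hmod : ∀ c (z : ℤ), |Real.sin (Real.pi * (t - (c + z)))| = |Real.sin (Real.pi * (t - c))| :=
    fun c z => by rw [← sub_sub, abs_sin_pi_mul_sub_int]
  rw [hrest, hx'i, hx'k, ha, hb, hmod, hmod, hmod, hmod]
  exact mul_le_mul_of_nonneg_right (hle t ht)
    (Finset.prod_nonneg fun _ _ => Real.rpow_nonneg (abs_nonneg _) _)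

theorem eventually_weightedSupNorm_spread_lt (hν : ∀ j, 0 < ν j) (hw_nonneg : ∀ t, 0 ≤ w t)
    (hw_bdd : BddAbove (range w)) (hw_per : Function.Periodic w 1) {x : Fin n → ℝ} {i k : Fin n}
    (hik : i ≠ k) {a b : ℝ} {m l : ℤ} (ha : x i = a + m) (hb : x k = b + l) (hab : a ≤ b)
    {S : ℝ} (hS : ∀ t ∈ Icc a b, w t * rtp ν x t ≤ S) (hSN : S < weightedSupNorm w (rtp ν x))
    (hpos : 0 < weightedSupNorm w (rtp ν x)) :
    ∀ᶠ h in 𝓝[>] (0 : ℝ), weightedSupNorm w (rtp ν fun j => x j + h * spread ν i k j) <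
      weightedSupNorm w (rtp ν x) := by
  set N := weightedSupNorm w (rtp ν x) with hN
  obtain ⟨B, hB⟩ := hw_bdd
  have hwB : ∀ t, w t ≤ B := fun t => hB ⟨t, rfl⟩
  have hB0 : 0 ≤ B := (hw_nonneg 0).trans (hwB 0)
  have hcx : Continuous (rtp ν x) := continuous_rtp hν x
  obtain ⟨η₁, hη₁, hs₁⟩ := exists_weighted_rtp_le_near_zero hν ⟨B, hB⟩ (half_pos hpos) (x := x) (c := a)
    (rtp_eq_zero_of_eq_add_int hν (j := i) (m := -m) (by push_cast; linarith))
  obtain ⟨η₂, hη₂, hs₂⟩ := exists_weighted_rtp_le_near_zero hν ⟨B, hB⟩ (half_pos hpos) (x := x) (c := b)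
    (rtp_eq_zero_of_eq_add_int hν (j := k) (m := -l) (by push_cast; linarith))
  set η := min η₁ η₂ with hη
  have hη0 : 0 < η := lt_min hη₁ hη₂
  -- The contraction holds only at distance `η` from the arc. In the collars of width `η` the
  -- product is near its zeros `a` and `b`, which bounds the weighted product by `N / 2`.
  set S' := max S (N / 2) with hS'
  have hS'N : S' < N := max_lt hSN (by linarith)
  have hinner : ∀ t ∈ Icc (a - η) (b + η), w t * rtp ν x t ≤ S' := by
    intro t ht
    have := min_le_left η₁ η₂
    have := min_le_right η₁ η₂
    rcases lt_or_ge t a with h1 | h1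
    · exact (hs₁ t (by rw [abs_le]; constructor <;> linarith [ht.1])).trans (le_max_right _ _)
    · rcases le_or_gt t b with h2 | h2
      · exact (hS t ⟨h1, h2⟩).trans (le_max_left _ _)
      · exact (hs₂ t (by rw [abs_le]; constructor <;> linarith [ht.2])).trans (le_max_right _ _)
  -- uniform closeness on the inner arc
  obtain ⟨ε, hε, hBε⟩ : ∃ ε > 0, B * ε ≤ (N - S') / 2 := by
    refine ⟨(N - S') / 2 / (B + 1), div_pos (by linarith) (by linarith), ?_⟩
    rw [mul_div_assoc', div_le_iff₀ (by linarith)]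
    nlinarith
  have hclose : ∀ᶠ h in 𝓝 (0 : ℝ), ∀ t ∈ Icc (a - η) (b + η),
      rtp ν (fun j => x j + h * spread ν i k j) t < rtp ν x t + ε := by
    refine isCompact_Icc.eventually_forall_of_forall_eventually fun t _ => ?_
    have hc : Continuous fun y : ℝ × ℝ => rtp ν (fun j => x j + y.1 * spread ν i k j) y.2 :=
      Continuous.rtp hν (by fun_prop) continuous_snd
    have hc' : Continuous fun y : ℝ × ℝ => rtp ν x y.2 + ε :=
      (hcx.comp continuous_snd).add continuous_const
    exact hc.continuousAt.eventually_lt hc'.continuousAt (by simpa using hε)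
  have hsh : ∀ p > (0 : ℝ), ∀ᶠ h in 𝓝 (0 : ℝ), h / p < η := fun p _ =>
    ((continuous_id.div_const p).tendsto 0).eventually_lt_const (by simpa using hη0)
  filter_upwards [self_mem_nhdsWithin, nhdsWithin_le_nhds hclose,
    nhdsWithin_le_nhds (hsh (ν i) (hν i)), nhdsWithin_le_nhds (hsh (ν k) (hν k))] with h hh hcl hi hk
  have hh : 0 < h := hh
  set x' := fun j => x j + h * spread ν i k j with hx'
  obtain ⟨ρ, hρ0, hρ1, hρ⟩ := exists_contraction_rtp_spread hν hik ha hb hab hh hi hk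
  refine lt_of_le_of_lt (weightedSupNorm_rtp_le (C := max ((N + S') / 2) (ρ * N)) fun t => ?_)
    (max_lt (by linarith) (by nlinarith))
  -- reduce to one period
  have hred : w t * rtp ν x' t =
      w (t - ⌊t - (a - η)⌋) * rtp ν x' (t - ⌊t - (a - η)⌋) := by
    rw [rtp_sub_int]
    congr 1
    have := hw_per.sub_int_mul_eq (x := t) ⌊t - (a - η)⌋
    rw [mul_one] at this
    exact this.symm
  rw [hred]
  have hlo := Int.floor_le (t - (a - η))
  have hhi := Int.lt_floor_add_one (t - (a - η))
  set s := t - ⌊t - (a - η)⌋ with hs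
  rcases le_or_gt s (b + η) with hsb | hsb
  · have hsI : s ∈ Icc (a - η) (b + η) := ⟨by linarith, hsb⟩
    refine le_trans ?_ (le_max_left _ _)
    calc w s * rtp ν x' s ≤ w s * (rtp ν x s + ε) :=
          mul_le_mul_of_nonneg_left (hcl s hsI).le (hw_nonneg s)
      _ = w s * rtp ν x s + w s * ε := mul_add _ _ _
      _ ≤ S' + B * ε := add_le_add (hinner s hsI) (mul_le_mul_of_nonneg_right (hwB s) hε.le)
      _ ≤ (N + S') / 2 := by linarith
  · refine le_trans ?_ (le_max_right _ _)
    calc w s * rtp ν x' s ≤ w s * (ρ * rtp ν x s) :=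
          mul_le_mul_of_nonneg_left (hρ s ⟨hsb.le, by linarith⟩) (hw_nonneg s)
      _ = ρ * (w s * rtp ν x s) := by ring
      _ ≤ ρ * N := mul_le_mul_of_nonneg_left (le_weightedSupNorm_rtp hν hw_nonneg ⟨B, hB⟩ x s) hρ0

end Perturbation

/-! ### Coincident nodes and preservation of the cyclic order -/

section Ordering

variable {n : ℕ} {x : Fin n → ℝ}

theorem CyclicMono.le (hx : CyclicMono x) {i j : Fin n} (hij : i ≤ j) :
    x i ≤ x j ∧ x j ≤ x i + 1 := by
  rcases hij.eq_or_lt with rfl | h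
  · exact ⟨le_rfl, by linarith⟩
  · exact hx i j h

/-- The first node, cyclically, among those that coincide with `x j₀` modulo `1`. -/
theorem exists_first_congruent (x : Fin n → ℝ) (j₀ : Fin n) :
    ∃ (i : Fin n) (m : ℤ), x i = x j₀ + m ∧
      ∀ j, (j < i → x j ≠ x i) ∧ (i < j → x j ≠ x i + 1) := by
  classical
  set G : Finset (Fin n) := {j | ∃ m : ℤ, x j = x j₀ + m} with hG
  -- The largest value in the class excludes a node at `x i + 1`; the least index with that value
  -- excludes an earlier node at `x i`.
  obtain ⟨e, heG, hmax⟩ := G.exists_max_image x ⟨j₀, by simp [hG]⟩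
  obtain ⟨i, hi, hmin⟩ := (G.filter fun j => x j = x e).exists_min_image id
    ⟨e, by simpa using heG⟩
  simp only [Finset.mem_filter, hG, Finset.mem_univ, true_and] at hi
  obtain ⟨⟨m, hm⟩, hie⟩ := hi
  refine ⟨i, m, hm, fun j => ⟨fun hji hjx => ?_, fun _ hjx => ?_⟩⟩
  · refine absurd (hmin j ?_) (not_le.2 hji)
    simp only [Finset.mem_filter, hG, Finset.mem_univ, true_and]
    exact ⟨⟨m, hjx.trans hm⟩, hjx.trans hie⟩
  · have := hmax j (by
      simp only [Finset.mem_filter, hG, Finset.mem_univ, true_and]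
      exact ⟨m + 1, by push_cast; linarith⟩)
    linarith

/-- The last node, cyclically, among those that coincide with `x j₀` modulo `1`. -/
theorem exists_last_congruent (x : Fin n → ℝ) (j₀ : Fin n) :
    ∃ (k : Fin n) (m : ℤ), x k = x j₀ + m ∧
      ∀ j, (k < j → x j ≠ x k) ∧ (j < k → x k ≠ x j + 1) := by
  classical
  set G : Finset (Fin n) := {j | ∃ m : ℤ, x j = x j₀ + m} with hG
  obtain ⟨e, heG, hmin⟩ := G.exists_min_image x ⟨j₀, by simp [hG]⟩
  obtain ⟨i, hi, hmax⟩ := (G.filter fun j => x j = x e).exists_max_image id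
    ⟨e, by simpa using heG⟩
  simp only [Finset.mem_filter, hG, Finset.mem_univ, true_and] at hi
  obtain ⟨⟨m, hm⟩, hie⟩ := hi
  refine ⟨i, m, hm, fun j => ⟨fun hji hjx => ?_, fun _ hjx => ?_⟩⟩
  · refine absurd (hmax j ?_) (not_le.2 hji)
    simp only [Finset.mem_filter, hG, Finset.mem_univ, true_and]
    exact ⟨⟨m, hjx.trans hm⟩, hjx.trans hie⟩
  · have := hmin j (by
      simp only [Finset.mem_filter, hG, Finset.mem_univ, true_and]
      exact ⟨m - 1, by push_cast; linarith⟩)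
    linarith

theorem CyclicMono.eq_or_of_congruent (hx : CyclicMono x) {i j : Fin n} (hij : i < j) {m : ℤ}
    (hm : x j = x i + m) : x j = x i ∨ x j = x i + 1 := by
  obtain ⟨h0, h1⟩ := hx i j hij
  have m0 : (-1 : ℤ) < m := by exact_mod_cast (by push_cast; linarith : ((-1 : ℤ) : ℝ) < m)
  have m1 : m < 2 := by exact_mod_cast (by push_cast; linarith : (m : ℝ) < ((2 : ℤ) : ℝ))
  obtain rfl | rfl : m = 0 ∨ m = 1 := by omega
  · left; simpa using hm
  · right; simpa using hm

/-- A node that is both the first and the last one of its class modulo `1` is alone in it. -/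
theorem CyclicMono.eq_of_first_of_last (hx : CyclicMono x) {e j : Fin n} {m : ℤ}
    (hfirst : ∀ j, (j < e → x j ≠ x e) ∧ (e < j → x j ≠ x e + 1))
    (hlast : ∀ j, (e < j → x j ≠ x e) ∧ (j < e → x e ≠ x j + 1)) (hm : x j = x e + m) :
    j = e := by
  rcases lt_trichotomy j e with h | h | h
  · rcases hx.eq_or_of_congruent (m := -m) h (by push_cast; linarith) with h1 | h1
    · exact absurd h1.symm ((hfirst j).1 h)
    · exact absurd h1 ((hlast j).2 h)
  · exact h
  · rcases hx.eq_or_of_congruent h hm with h1 | h1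
    · exact absurd h1 ((hlast j).1 h)
    · exact absurd h1 ((hfirst j).2 h)

theorem eventually_add_mul_le {a b c d : ℝ} (hab : a ≤ b) (h : a = b → c ≤ d) :
    ∀ᶠ s in 𝓝[>] (0 : ℝ), a + s * c ≤ b + s * d := by
  rcases hab.eq_or_lt with rfl | hlt
  · filter_upwards [self_mem_nhdsWithin] with s hs
    have := mul_le_mul_of_nonneg_left (h rfl) (le_of_lt hs)
    linarith
  · have hc : Continuous fun s : ℝ => a + s * c := by fun_prop
    have hd : Continuous fun s : ℝ => b + s * d := by fun_prop
    have := (hc.tendsto 0).eventually_lt (hd.tendsto 0) (by simpa using hlt)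
    exact nhdsWithin_le_nhds (this.mono fun s hs => hs.le)

theorem spread_nonpos {ν : Fin n → ℝ} (hν : ∀ j, 0 < ν j) {i k j : Fin n} (hj : j ≠ k) :
    spread ν i k j ≤ 0 := by
  have := hν i
  unfold spread
  split_ifs
  · simp only [Left.neg_nonpos_iff]; positivity
  · exact le_rfl

theorem spread_nonneg {ν : Fin n → ℝ} (hν : ∀ j, 0 < ν j) {i k j : Fin n} (hj : j ≠ i) :
    0 ≤ spread ν i k j := by
  have := hν k
  rw [spread, if_neg hj]
  split_ifs
  · positivity
  · exact le_rfl

/-- Only tight order constraints can break under a small move. At a tight one, the choice of `i` and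
`k` gives the lower side a nonpositive velocity and the upper side a nonnegative one. -/
theorem CyclicMono.eventually_spread {ν : Fin n → ℝ} (hν : ∀ j, 0 < ν j) (hx : CyclicMono x)
    {i k : Fin n} (hi : ∀ j, (j < i → x j ≠ x i) ∧ (i < j → x j ≠ x i + 1))
    (hk : ∀ j, (k < j → x j ≠ x k) ∧ (j < k → x k ≠ x j + 1)) :
    ∀ᶠ h in 𝓝[>] (0 : ℝ), CyclicMono fun j => x j + h * spread ν i k j := by
  simp only [CyclicMono, eventually_all]
  intro j j' hjj'
  obtain ⟨h0, h1⟩ := hx j j' hjj'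
  refine (eventually_add_mul_le h0 fun he => ?_).and ?_
  · refine (spread_nonpos hν ?_).trans (spread_nonneg hν ?_)
    · rintro rfl; exact (hk j').1 hjj' he.symm
    · rintro rfl; exact (hi j).1 hjj' he
  · refine (eventually_add_mul_le h1 fun he => ?_).mono fun s hs => hs.trans_eq (add_right_comm _ _ _)
    refine (spread_nonpos hν ?_).trans (spread_nonneg hν ?_)
    · rintro rfl; exact (hk j).2 hjj' he
    · rintro rfl; exact (hi j').2 hjj' he

/-- The last clause ensures that even a degenerate arc is bounded by two different nodes, which can
then be pulled apart. -/
theorem CyclicMono.nextNode_spec (hx : CyclicMono x) (j : Fin n) :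
    ∃ (j₁ : Fin n) (l : ℤ), x j₁ = nextNode x j + l ∧ x j ≤ nextNode x j ∧
      nextNode x j ≤ x j + 1 ∧ (nextNode x j = x j → j₁ ≠ j) := by
  unfold nextNode
  split_ifs with h
  · obtain ⟨h0, h1⟩ := hx j ⟨j + 1, h⟩ (Nat.lt_succ_self _)
    refine ⟨⟨j + 1, h⟩, 0, by simp, h0, h1, fun _ he => ?_⟩
    have := congrArg Fin.val he
    simp at this
  · obtain ⟨h0, h1⟩ := hx.le (i := ⟨0, j.pos⟩) (j := j) (Nat.zero_le _)
    refine ⟨⟨0, j.pos⟩, -1, by simp, h1, by linarith, fun he he' => ?_⟩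
    rw [he'] at he
    linarith

end Ordering

/-! ### Equioscillation, strict ordering and reality of minimizers -/

section Equioscillation

variable {n : ℕ} {ν : Fin n → ℝ} {w : ℝ → ℝ}

theorem weightedSupNorm_rtp_le_of_period (hw_per : Function.Periodic w 1) {x : Fin n → ℝ} {a S : ℝ}
    (hS : ∀ t ∈ Icc a (a + 1), w t * rtp ν x t ≤ S) : weightedSupNorm w (rtp ν x) ≤ S := by
  refine weightedSupNorm_rtp_le fun t => ?_
  have h1 := hw_per.sub_int_mul_eq (x := t) ⌊t - a⌋
  rw [mul_one] at h1
  rw [← h1, ← rtp_sub_int x t ⌊t - a⌋]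
  have := Int.floor_le (t - a)
  have := Int.lt_floor_add_one (t - a)
  exact hS _ ⟨by linarith, by linarith⟩

/-- If the weighted product stays below its norm on one arc between consecutive nodes, then the
nodes are not optimal. -/
theorem exists_cyclicMono_weightedSupNorm_lt (hν : ∀ j, 0 < ν j) (hw_nonneg : ∀ t, 0 ≤ w t)
    (hw_bdd : BddAbove (range w)) (hw_per : Function.Periodic w 1) {x : Fin n → ℝ}
    (hx : CyclicMono x) {j : Fin n} {S : ℝ}
    (hS : ∀ t ∈ Icc (x j) (nextNode x j), w t * rtp ν x t ≤ S)
    (hSN : S < weightedSupNorm w (rtp ν x)) (hpos : 0 < weightedSupNorm w (rtp ν x)) :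
    ∃ y : Fin n → ℝ, CyclicMono y ∧
      weightedSupNorm w (rtp ν y) < weightedSupNorm w (rtp ν x) := by
  obtain ⟨j₁, l, hl, hle, hle1, hne⟩ := hx.nextNode_spec j
  have hlt1 : nextNode x j < x j + 1 := by
    -- An arc of length 1 is a full period, on which `S` would bound the norm itself.
    refine lt_of_le_of_ne hle1 fun he => ?_
    rw [he] at hS
    exact absurd hSN (not_lt.2 (weightedSupNorm_rtp_le_of_period hw_per hS))
  obtain ⟨i, m, him, hi⟩ := exists_first_congruent x j
  obtain ⟨k, l', hkl, hk⟩ := exists_last_congruent x j₁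
  have hkl' : x k = nextNode x j + ((l + l' : ℤ) : ℝ) := by rw [hkl, hl]; push_cast; ring
  -- If `i = k`, the arc's ends are congruent modulo 1, hence equal as its length is below 1. A node
  -- both first and last is alone in its class, so `j₁ = j`, against `hne`.
  have hik : i ≠ k := by
    rintro rfl
    have hint : nextNode x j = x j + ((m - (l + l') : ℤ) : ℝ) := by
      push_cast at hkl' ⊢; linarith
    have h0 : (-1 : ℤ) < m - (l + l') := by
      have : ((-1 : ℤ) : ℝ) < ((m - (l + l') : ℤ) : ℝ) := by push_cast at hint ⊢; linarith
      exact_mod_cast this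
    have h1 : m - (l + l') < 1 := by
      have : ((m - (l + l') : ℤ) : ℝ) < ((1 : ℤ) : ℝ) := by push_cast at hint ⊢; linarith
      exact_mod_cast this
    have h2 : m - (l + l') = 0 := by omega
    rw [h2, Int.cast_zero, add_zero] at hint
    have e0 := hx.eq_of_first_of_last (j := j) (m := -m) hi hk (by push_cast; linarith)
    have e1 := hx.eq_of_first_of_last (j := j₁) (m := -l') hi hk (by push_cast; linarith)
    exact hne hint (e1.trans e0.symm)
  obtain ⟨h, h1, h2⟩ := ((hx.eventually_spread hν hi hk).and
    (eventually_weightedSupNorm_spread_lt hν hw_nonneg hw_bdd hw_per hik him hkl' hle hS hSN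
      hpos)).exists
  exact ⟨_, h1, h2⟩

theorem sSup_arc_eq_minimaxValue (hn : 1 ≤ n) (hν : ∀ j, 0 < ν j) (hw_nonneg : ∀ t, 0 ≤ w t)
    (hw_bdd : BddAbove (range w)) (hw_per : Function.Periodic w 1) {x : Fin n → ℝ}
    (hx : CyclicMono x) (hmin : weightedSupNorm w (rtp ν x) = minimaxValue w ν)
    (hpos : 0 < weightedSupNorm w (rtp ν x)) (j : Fin n) :
    sSup ((fun t => w t * rtp ν x t) '' Icc (x j) (nextNode x j)) = minimaxValue w ν := by
  obtain ⟨-, -, -, hle, -, -⟩ := hx.nextNode_spec j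
  have hub : ∀ t, w t * rtp ν x t ≤ minimaxValue w ν := fun t =>
    hmin ▸ le_weightedSupNorm_rtp hν hw_nonneg hw_bdd x t
  refine le_antisymm (csSup_le ((nonempty_Icc.2 hle).image _) ?_) (not_lt.1 fun hlt => ?_)
  · rintro _ ⟨t, -, rfl⟩
    exact hub t
  · have hbdd : BddAbove ((fun t => w t * rtp ν x t) '' Icc (x j) (nextNode x j)) :=
      ⟨minimaxValue w ν, by rintro _ ⟨t, -, rfl⟩; exact hub t⟩
    obtain ⟨y, hy, hlt'⟩ := exists_cyclicMono_weightedSupNorm_lt hν hw_nonneg hw_bdd hw_per hx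
      (fun t ht => le_csSup hbdd (mem_image_of_mem _ ht)) (hmin ▸ hlt) hpos
    exact absurd (minimaxValue_le_of_cyclicMono hn hw_nonneg hy) (not_le.2 (hmin ▸ hlt'))

theorem lt_nextNode_of_sSup_arc_pos (hν : ∀ j, 0 < ν j) {x : Fin n → ℝ} (hx : CyclicMono x)
    {j : Fin n} (h : 0 < sSup ((fun t => w t * rtp ν x t) '' Icc (x j) (nextNode x j))) :
    x j < nextNode x j := by
  obtain ⟨-, -, -, hle, -, -⟩ := hx.nextNode_spec j
  refine lt_of_le_of_ne hle fun he => ?_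
  rw [← he, Icc_self, image_singleton, csSup_singleton,
    rtp_eq_zero_of_eq_add_int hν (j := j) (m := 0) (by simp), mul_zero] at h
  exact lt_irrefl _ h

theorem CyclicMono.strictMono_of_lt_nextNode {x : Fin n → ℝ} (hx : CyclicMono x)
    (h : ∀ j, x j < nextNode x j) : StrictMono x := by
  intro i j hij
  have hlt : (i : ℕ) + 1 < n := lt_of_le_of_lt (Nat.succ_le_of_lt hij) j.2
  have := h i
  rw [nextNode, dif_pos hlt] at this
  exact this.trans_le (hx.le (show (⟨i + 1, hlt⟩ : Fin n) ≤ j from Nat.succ_le_of_lt hij)).1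

theorem CyclicMono.exists_open_period {x : Fin n → ℝ} (hn : 1 ≤ n) (hx : CyclicMono x)
    (h : ∀ j, x j < nextNode x j) : ∃ c : ℝ, ∀ j, c < x j ∧ x j < c + 1 := by
  have hl := h ⟨n - 1, by omega⟩
  rw [nextNode, dif_neg (by simp only; omega)] at hl
  -- The midpoint of the gap between the last node shifted by `-1` and the first node.
  refine ⟨(x ⟨n - 1, by omega⟩ - 1 + x ⟨0, hn⟩) / 2, fun j => ?_⟩
  have h0 := (hx.le (show (⟨0, hn⟩ : Fin n) ≤ j from Nat.zero_le _)).1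
  have h1 := (hx.le (show j ≤ (⟨n - 1, by omega⟩ : Fin n) from Nat.le_sub_one_of_lt j.2)).1
  constructor <;> linarith

theorem im_eq_zero_of_minimizer (hn : 1 ≤ n) (hν : ∀ j, 0 < ν j) (hw_nonneg : ∀ t, 0 ≤ w t)
    (hw_bdd : BddAbove (range w)) {z : Fin n → ℂ} (hz : CyclicallyOrdered z)
    (hmin : weightedSupNorm w (gtp ν z) = minimaxValue w ν)
    (hpos : 0 < weightedSupNorm w (rtp ν fun j => (z j).re)) (j : Fin n) : (z j).im = 0 := by
  by_contra him
  have h1 : 1 < Real.cosh (Real.pi * (z j).im) ^ ν j :=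
    Real.one_lt_rpow (Real.one_lt_cosh.2 (mul_ne_zero Real.pi_ne_zero him)) (hν j)
  have h2 := cosh_rpow_mul_weightedSupNorm_le hν hw_nonneg hw_bdd z j
  have h3 := minimaxValue_le_of_cyclicMono (ν := ν) hn hw_nonneg hz.cyclicMono
  nlinarith

end Equioscillation

theorem theorem1 (n : ℕ) (hn : 1 ≤ n) (ν : Fin n → ℝ) (hν : ∀ j, 0 < ν j)
    (w : ℝ → ℝ) (hw_nonneg : ∀ t, 0 ≤ w t) (hw_bdd : BddAbove (Set.range w))
    (hw_per : Function.Periodic w 1)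
    (hw_pos : (n : ℕ∞) < Set.encard {t : ℝ | t ∈ Set.Ico (0 : ℝ) 1 ∧ 0 < w t}) :
    (∃ z : Fin n → ℂ, CyclicallyOrdered z ∧
      weightedSupNorm w (gtp ν z) = minimaxValue w ν) ∧
    (∀ z : Fin n → ℂ, CyclicallyOrdered z →
      weightedSupNorm w (gtp ν z) = minimaxValue w ν →
      ∃ x : Fin n → ℝ, (∀ j, z j = (x j : ℂ)) ∧
        (∃ c : ℝ, StrictMono x ∧ ∀ j, c < x j ∧ x j < c + 1) ∧
        ∀ j : Fin n,
          sSup ((fun t : ℝ => w t * gtp ν z t) '' Set.Icc (x j) (nextNode x j)) =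
            minimaxValue w ν) := by
  refine ⟨exists_minimizer hn hν hw_nonneg hw_bdd, fun z hz hmin => ?_⟩
  have hpos := weightedSupNorm_rtp_pos hν hw_nonneg hw_bdd hw_pos fun j => (z j).re
  have hre : ∀ j, z j = ((z j).re : ℂ) := fun j => Complex.ext rfl
    (by simpa using im_eq_zero_of_minimizer hn hν hw_nonneg hw_bdd hz hmin hpos j)
  have hgtp : gtp ν z = rtp ν fun j => (z j).re := by
    rw [← gtp_ofReal]; exact congrArg _ (funext hre)
  have hx := hz.cyclicMono
  rw [hgtp] at hmin ⊢
  have harc := sSup_arc_eq_minimaxValue hn hν hw_nonneg hw_bdd hw_per hx hmin hpos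
  have hnext : ∀ j, (z j).re < nextNode (fun j => (z j).re) j := fun j =>
    lt_nextNode_of_sSup_arc_pos (w := w) hν hx ((hmin ▸ hpos).trans_eq (harc j).symm)
  obtain ⟨c, hc⟩ := hx.exists_open_period hn hnext
  exact ⟨fun j => (z j).re, hre, ⟨c, hx.strictMono_of_lt_nextNode hnext, hc⟩, harc⟩
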